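/- For an integer $n\ge 1$ and a tuple $\mu=(\mu_1,\dots,\mu_n)$ of nonnegative integers let $a_\mu(x_1,\dots,x_n)=\det\big(x_i^{\mu_j}\big)_{1\le i,j\le n}$, and for $k\ge 1$ let $\lambda(k)=(k-1,k-2,\dots,1)$ be the staircase partition, padded with zeros to length $n$ where necessary. The Schur polynomial in $n$ variables corresponding to a partition $\mu$ with at most $n$ parts is the polynomial $$ s_\mu=\frac{a_{\mu+\lambda(n)}}{a_{\lambda(n)}}\in\mathbb{Z}[x_1,\dots,x_n] $$ (the division is exact in $\mathbb{Z}[x_1,\dots,x_n]$, so $s_\mu$ can be evaluated at points with repeated coordinates). Let $m\ge 0$ be an integer, let $a>-1$ be real, and let $w\in\mathbb{C}$ satisfy $\operatorname{Re} w>0$ and $a=\tfrac12\,(w^2+w^{-2})$. Let $\mathbf q=(w,\dots,w,w^{-1},\dots,w^{-1})\in\mathbb{C}^{2m+2}$ with $m+1$ copies each of $w$ and $w^{-1}$. Then the integral below converges, $s_{\lambda(2m+2)}(\mathbf q)\ne 0$, and $$ N_{0,4}(a;m):=\int_0^\infty\frac{dx}{(x^4+2ax^2+1)^{m+1}}=\frac{\pi}{2}\,\frac{s_{\lambda(2m+1)}(\mathbf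 q)}{s_{\lambda(2m+2)}(\mathbf q)}, $$ where both Schur polynomials are taken in $n=2m+2$ variables. -/

import Mathlib

/-- The quartic integral `N_{0,4}(a;m) = ∫₀^∞ dx / (x⁴ + 2 a x² + 1)^(m+1)`. -/
noncomputable def quarticIntegral (a : ℝ) (m : ℕ) : ℝ :=
  ∫ x in Set.Ioi (0 : ℝ), 1 / (x ^ 4 + 2 * a * x ^ 2 + 1) ^ (m + 1)

/-- The alternant `a_μ = det (X_i ^ μ_j)` in `n` variables, as a polynomial. -/
noncomputable def alternant {n : ℕ} (μ : Fin n → ℕ) : MvPolynomial (Fin n) ℤ :=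
  (Matrix.of fun i j : Fin n => (MvPolynomial.X i : MvPolynomial (Fin n) ℤ) ^ μ j).det

/-- The staircase partition `λ(k) = (k-1, k-2, …, 1)`, padded with zeros to an `n`-tuple
(used for `k ≤ n + 1`). -/
def staircase (n k : ℕ) : Fin n → ℕ := fun i => k - 1 - (i : ℕ)

theorem irreducible_X_sub_X {n : ℕ} {i j : Fin n} (hij : i ≠ j) :
    Irreducible (MvPolynomial.X i - MvPolynomial.X j : MvPolynomial (Fin n) ℤ) := by
  classical
  have hc : MvPolynomial.coeff (Finsupp.single i 1)
      (MvPolynomial.X i - MvPolynomial.X j : MvPolynomial (Fin n) ℤ) = 1 := by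
    rw [MvPolynomial.coeff_sub, MvPolynomial.coeff_X, MvPolynomial.coeff_X, if_pos rfl,
      if_neg (fun h => hij ((Finsupp.single_left_injective one_ne_zero h).symm)), sub_zero]
  apply MvPolynomial.irreducible_of_totalDegree_eq_one
  · apply le_antisymm
    · refine (MvPolynomial.totalDegree_sub _ _).trans ?_
      simp
    · have := MvPolynomial.le_totalDegree (p := (MvPolynomial.X i - MvPolynomial.X j :
        MvPolynomial (Fin n) ℤ)) (s := Finsupp.single i 1)
        (by rw [MvPolynomial.mem_support_iff, hc]; exact one_ne_zero)
      simpa using this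
  · intro x hx
    have := hx (Finsupp.single i 1)
    rw [hc] at this
    exact isUnit_of_dvd_one this

theorem X_sub_X_dvd_alternant {n : ℕ} (μ : Fin n → ℕ) {i j : Fin n} (hij : i ≠ j) :
    (MvPolynomial.X i - MvPolynomial.X j : MvPolynomial (Fin n) ℤ) ∣ alternant μ := by
  rw [← Ideal.mem_span_singleton, ← Ideal.Quotient.eq_zero_iff_mem, alternant, RingHom.map_det]
  refine Matrix.det_zero_of_row_eq hij ?_
  funext k
  simp only [RingHom.mapMatrix_apply, Matrix.map_apply, Matrix.of_apply, map_pow]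
  congr 1
  rw [Ideal.Quotient.eq]
  exact Ideal.mem_span_singleton_self _

theorem alternant_staircase (n : ℕ) :
    alternant (staircase n n) =
      ∏ p : (Σ _ : Fin n, Fin n) with p.1 < p.2,
        (MvPolynomial.X p.1 - MvPolynomial.X p.2 : MvPolynomial (Fin n) ℤ) := by
  have h : (Matrix.of fun i j : Fin n =>
      (MvPolynomial.X i : MvPolynomial (Fin n) ℤ) ^ staircase n n j) =
      Matrix.projVandermonde 1 MvPolynomial.X := by
    ext1 i j
    have : n - 1 - (j : ℕ) = n - (j + 1) := by omega
    simp [Matrix.projVandermonde_apply, staircase, Fin.val_rev, this]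
  rw [alternant, h, Matrix.det_projVandermonde, Finset.prod_sigma']
  refine Finset.prod_congr ?_ ?_
  · ext p; simp
  · intro p _; simp

/-- The alternant of the staircase divides every alternant. -/
theorem alternant_staircase_dvd {n : ℕ} (μ : Fin n → ℕ) :
    alternant (staircase n n) ∣ alternant μ := by
  rw [alternant_staircase]
  refine Finset.prod_dvd_of_isRelPrime ?_ ?_
  · rintro ⟨i, j⟩ hp ⟨k, l⟩ hq hne
    simp only [Finset.coe_filter, Finset.mem_univ, true_and, Set.mem_ofPred_eq] at hp hq
    refine (irreducible_X_sub_X hp.ne).isRelPrime_iff_not_dvd.2 fun ⟨c, hc⟩ => ?_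
    have h1 := congrArg
      (MvPolynomial.eval fun t : Fin n => if t = j then ((i : ℕ) : ℤ) else ((t : ℕ) : ℤ)) hc
    simp only [MvPolynomial.eval_sub, MvPolynomial.eval_mul, MvPolynomial.eval_X, if_true,
      if_neg hp.ne, sub_self, zero_mul] at h1
    apply hne
    simp only [Sigma.mk.injEq, heq_eq_eq]
    simp only [Fin.ext_iff, Fin.lt_def] at *
    split_ifs at h1 <;> omega
  · rintro ⟨i, j⟩ hp
    simp only [Finset.mem_filter, Finset.mem_univ, true_and] at hp
    exact X_sub_X_dvd_alternant μ hp.ne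

/-- The Schur polynomial `s_μ = a_{μ+λ(n)} / a_{λ(n)}` in `n` variables: the quotient is taken in
the polynomial ring `ℤ[X_1, …, X_n]`, where it is exact, so that `s_μ` can also be evaluated at
points with repeated coordinates. -/
noncomputable def schurPoly {n : ℕ} (μ : Fin n → ℕ) : MvPolynomial (Fin n) ℤ :=
  Classical.choose (alternant_staircase_dvd (μ + staircase n n))

/-- The equation `a_{μ+λ(n)} = a_{λ(n)} s_μ`. -/
theorem alternant_add_staircase {n : ℕ} (μ : Fin n → ℕ) :
    alternant (μ + staircase n n) = alternant (staircase n n) * schurPoly μ :=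
  Classical.choose_spec (alternant_staircase_dvd (μ + staircase n n))

/-- Since `a_{λ(n)} ≠ 0`, the equation above determines `s_μ`. -/
theorem alternant_staircase_ne_zero (n : ℕ) : alternant (staircase n n) ≠ 0 := by
  rw [alternant_staircase, Finset.prod_ne_zero_iff]
  rintro ⟨i, j⟩ hp
  simp only [Finset.mem_filter, Finset.mem_univ, true_and] at hp
  exact (irreducible_X_sub_X hp.ne).ne_zero

/-- The value `s_μ(q)` of the Schur function at `q ∈ ℂⁿ`. -/
noncomputable def schur {n : ℕ} (μ : Fin n → ℕ) (q : Fin n → ℂ) : ℂ :=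
  MvPolynomial.aeval q (schurPoly μ)

/-- The `(2m+2)`-tuple `(w, …, w, w⁻¹, …, w⁻¹)` with `m+1` copies of each of `w` and `w⁻¹`. -/
noncomputable def quarticTuple (w : ℂ) (m : ℕ) : Fin (2 * m + 2) → ℂ :=
  fun i => if (i : ℕ) < m + 1 then w else w⁻¹

/-! Since `x⁴ + 2ax² + 1 = (x² + w²)(x² + w⁻²)`, the integrand is `∏ 1/(x² + qᵢ²)`. For nodes with
positive real part and distinct squares, partial fractions and `∫₀^∞ dt/(t² + z²) = π/(2z)` turn the
integral into a divided difference of `y ↦ y^(-1/2)` at the `xᵢ²`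
(`integral_prod_inv_sq_add_sq_of_injective`). That divided difference is a quotient of alternants,
hence of Schur polynomials (`schur_staircase_eq`). With denominators cleared, the identity extends
by continuity to repeated nodes (`integral_prod_inv_sq_add_sq`). The denominator `∏ (xᵢ + xⱼ)` has
no zero where all real parts are positive. -/

/-! ### Staircase Schur polynomials and divided differences. -/

/-- The Schur polynomial of the full staircase is the product of the pairwise sums. -/
theorem schurPoly_staircase (n : ℕ) :
    schurPoly (staircase n n) =
      ∏ p : (Σ _ : Fin n, Fin n) with p.1 < p.2,
        (MvPolynomial.X p.1 + MvPolynomial.X p.2 : MvPolynomial (Fin n) ℤ) := by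
  apply mul_left_cancel₀ (alternant_staircase_ne_zero n)
  rw [← alternant_add_staircase]
  -- Doubling the exponents substitutes squares, so each Vandermonde factor becomes a difference of
  -- squares.
  have h : alternant (staircase n n + staircase n n) =
      MvPolynomial.aeval (fun i => (MvPolynomial.X i : MvPolynomial (Fin n) ℤ) ^ 2)
        (alternant (staircase n n)) := by
    rw [alternant, alternant, AlgHom.map_det]
    congr 1
    ext1 i j
    simp [← pow_mul, two_mul]
  rw [h, alternant_staircase, map_prod, ← Finset.prod_mul_distrib]
  refine Finset.prod_congr rfl fun p _ => ?_
  simp only [map_sub, MvPolynomial.aeval_X]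
  ring

theorem schur_staircase_ne_zero {n : ℕ} {x : Fin n → ℂ} (hx : ∀ i, 0 < (x i).re) :
    schur (staircase n n) x ≠ 0 := by
  rw [schur, schurPoly_staircase, map_prod, Finset.prod_ne_zero_iff]
  intro p _ h
  have := congrArg Complex.re h
  simp only [map_add, MvPolynomial.aeval_X, Complex.add_re, Complex.zero_re] at this
  linarith [hx p.1, hx p.2]

theorem aeval_alternant {n : ℕ} (μ : Fin n → ℕ) (x : Fin n → ℂ) :
    MvPolynomial.aeval x (alternant μ) = (Matrix.of fun i j => x i ^ μ j).det := by
  rw [alternant, AlgHom.map_det]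
  congr 1
  ext1 i j
  simp

theorem aeval_alternant_add_staircase {n : ℕ} (μ : Fin n → ℕ) (x : Fin n → ℂ) :
    (Matrix.of fun i j => x i ^ (μ j + staircase n n j)).det =
      (Matrix.of fun i j => x i ^ staircase n n j).det * schur μ x := by
  have h := congrArg (MvPolynomial.aeval x) (alternant_add_staircase μ)
  rwa [map_mul, aeval_alternant, aeval_alternant] at h

open scoped Matrix in
/-- Replacing the last column of a Vandermonde matrix by `v` multiplies the determinant by the
divided difference of `v` at the nodes. -/
theorem det_vandermonde_updateCol_last {F : Type*} [Field F] {n : ℕ} {y : Fin (n + 1) → F}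
    (hy : Function.Injective y) (v : Fin (n + 1) → F) :
    ((Matrix.vandermonde y).updateCol (Fin.last n) v).det =
      (∑ i, v i / ∏ j ∈ Finset.univ.erase i, (y i - y j)) * (Matrix.vandermonde y).det := by
  obtain ⟨p, hdeg, hev⟩ : ∃ p : Polynomial F, p.degree < (n + 1 : ℕ) ∧ ∀ i, p.eval (y i) = v i :=
    ⟨Lagrange.interpolate Finset.univ y v,
      (Lagrange.degree_interpolate_lt v hy.injOn).trans_eq (by simp),
      fun i => Lagrange.eval_interpolate_at_node v hy.injOn (Finset.mem_univ i)⟩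
  have hnat : p.natDegree < n + 1 := by
    rcases eq_or_ne p 0 with rfl | hp
    · simp
    · exact (Polynomial.natDegree_lt_iff_degree_lt hp).2 hdeg
  -- The new column is `V` times the coefficient vector of the interpolant, so Cramer's rule
  -- extracts its top coefficient, the divided difference.
  have hv : Matrix.vandermonde y *ᵥ (fun j : Fin (n + 1) => p.coeff j) = v := by
    ext i
    rw [← hev i, Polynomial.eval_eq_sum_range' hnat, Finset.sum_range]
    simp [Matrix.mulVec, dotProduct, mul_comm]
  have hc : p.coeff n = ∑ i, v i / ∏ j ∈ Finset.univ.erase i, (y i - y j) := by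
    have := Lagrange.coeff_eq_sum (s := Finset.univ) (v := y) hy.injOn (P := p) (by simpa using hdeg)
    simpa [hev] using this
  rw [← hc, ← Matrix.cramer_apply, Matrix.cramer_eq_adjugate_mulVec]
  rw [← hv, Matrix.mulVec_mulVec, Matrix.adjugate_mul]
  simp [Matrix.smul_mulVec, mul_comm]

/-- Both numerator alternants come from the Vandermonde matrix `V` in the squares: `2λ(n+1)` gives
`V` with columns reversed, and `λ(n) + λ(n+1)` has exponents `2n-1, …, 3, 1, 0`, which is `V` with
last column `xᵢ⁻¹`, rows scaled by `xᵢ`, columns permuted. -/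
theorem schur_staircase_eq {n : ℕ} {x : Fin (n + 1) → ℂ} (hx : ∀ i, x i ≠ 0)
    (hy : Function.Injective fun i => x i ^ 2) :
    schur (staircase (n + 1) n) x =
      (-1) ^ n * (∏ i, x i) *
        (∑ i, (x i)⁻¹ / ∏ j ∈ Finset.univ.erase i, (x i ^ 2 - x j ^ 2)) *
        schur (staircase (n + 1) (n + 1)) x := by
  have h1 := aeval_alternant_add_staircase (staircase (n + 1) n) x
  have h2 := aeval_alternant_add_staircase (staircase (n + 1) (n + 1)) x
  have hV := Matrix.det_vandermonde_ne_zero_iff.2 hy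
  set V := Matrix.vandermonde fun i => x i ^ 2 with hVdef
  have h3 : (Matrix.of fun i j =>
      x i ^ (staircase (n + 1) (n + 1) j + staircase (n + 1) (n + 1) j)).det =
      (Equiv.Perm.sign (Fin.revPerm (n := n + 1)) : ℂ) * V.det := by
    rw [← Matrix.det_permute']
    congr 1
    ext1 i j
    simp only [Matrix.of_apply, Matrix.submatrix_apply, id, hVdef, Matrix.vandermonde_apply,
      ← pow_mul, staircase, Fin.revPerm_apply, Fin.val_rev]
    congr 1
    omega
  have h4 : (∏ i, x i) * (V.updateCol (Fin.last n) fun i => (x i)⁻¹).det =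
      ((Matrix.of fun i j =>
        x i ^ (staircase (n + 1) n j + staircase (n + 1) (n + 1) j)).submatrix id
          (Fin.revPerm * finRotate (n + 1) : Equiv.Perm (Fin (n + 1)))).det := by
    rw [← Matrix.det_mul_column]
    congr 1
    ext1 i j
    simp only [Matrix.of_apply, Matrix.submatrix_apply, id, Equiv.Perm.mul_apply,
      Fin.revPerm_apply, Fin.val_rev, staircase, Matrix.updateCol_apply]
    split_ifs with h
    -- The last column has exponent `0`: truncated subtraction supplies the padding of `λ(n)`.
    · subst h
      rw [finRotate_last]
      simp [hx i]
    · rw [coe_finRotate_of_ne_last h, hVdef, Matrix.vandermonde_apply, ← pow_mul, ← pow_succ']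
      have := Fin.val_lt_last h
      congr 1
      omega
  rw [Matrix.det_permute', Equiv.Perm.sign_mul, sign_finRotate,
    det_vandermonde_updateCol_last hy, h1] at h4
  rw [h3] at h2
  set D := (Matrix.of fun i j => x i ^ staircase (n + 1) (n + 1) j).det
  set S := ∑ i, (x i)⁻¹ / ∏ j ∈ Finset.univ.erase i, (x i ^ 2 - x j ^ 2)
  have hs : ((Equiv.Perm.sign (Fin.revPerm (n := n + 1)) : ℤ) : ℂ) ^ 2 = 1 := by
    rcases Int.units_eq_one_or (Equiv.Perm.sign (Fin.revPerm (n := n + 1))) with h | h <;> simp [h]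
  have hn : ((-1 : ℂ) ^ n) ^ 2 = 1 := by rw [← pow_mul, mul_comm, pow_mul]; simp
  have hD : D ≠ 0 := by
    intro h
    rw [h, zero_mul] at h2
    rcases mul_eq_zero.1 h2 with h | h
    · simp [h] at hs
    · exact hV h
  apply mul_left_cancel₀ hD
  push_cast at h4
  set s := ((Equiv.Perm.sign (Fin.revPerm (n := n + 1)) : ℤ) : ℂ)
  linear_combination (-(-1 : ℂ) ^ n * s) * h4 + ((-1) ^ n * (∏ i, x i) * S) * h2
    - D * schur (staircase (n + 1) n) x * (hn * s ^ 2 + hs)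

/-! ### Uniform bounds and integrability. -/

theorem ofReal_sq_add_sq_ne_zero {z : ℂ} (hz : 0 < z.re) (t : ℝ) : (t : ℂ) ^ 2 + z ^ 2 ≠ 0 := by
  intro h
  have h' : ((t : ℂ) + Complex.I * z) * (t - Complex.I * z) = 0 := by
    linear_combination h - z ^ 2 * Complex.I_sq
  rcases mul_eq_zero.1 h' with h | h
  · have := congrArg Complex.im h
    simp at this
    linarith
  · have := congrArg Complex.im h
    simp at this
    linarith

/-- Each factor of `(t + iz)(t - iz)` has imaginary part `±Re z`. -/
theorem sq_le_norm_sq_add_sq {z : ℂ} {r : ℝ} (hr : 0 ≤ r) (hz : r ≤ z.re) (t : ℝ) :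
    r ^ 2 ≤ ‖(t : ℂ) ^ 2 + z ^ 2‖ := by
  have h' : (t : ℂ) ^ 2 + z ^ 2 = ((t : ℂ) + Complex.I * z) * (t - Complex.I * z) := by
    linear_combination z ^ 2 * Complex.I_sq
  rw [h', norm_mul, sq]
  have h1 := Complex.abs_im_le_norm ((t : ℂ) + Complex.I * z)
  have h2 := Complex.abs_im_le_norm ((t : ℂ) - Complex.I * z)
  simp only [Complex.add_im, Complex.sub_im, Complex.ofReal_im, Complex.I_mul_im, zero_add,
    zero_sub, abs_neg] at h1 h2
  have h3 := le_abs_self z.re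
  exact mul_le_mul (by linarith) (by linarith) hr (norm_nonneg _)

/-- A bound for `1 / (t² + z²)`, uniform in `z` with `r ≤ Re z` and `|z| ≤ R`. -/
theorem norm_inv_sq_add_sq_le {z : ℂ} {r R : ℝ} (hr : 0 < r) (hz : r ≤ z.re) (hR : ‖z‖ ≤ R)
    (t : ℝ) : ‖((t : ℂ) ^ 2 + z ^ 2)⁻¹‖ ≤ ((1 + R ^ 2) / r ^ 2 + 1) * (1 + t ^ 2)⁻¹ := by
  have h0 := sq_le_norm_sq_add_sq hr.le hz t
  have hr2 : 0 < r ^ 2 := by positivity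
  have hpos : 0 < ‖(t : ℂ) ^ 2 + z ^ 2‖ := hr2.trans_le h0
  have h1 : t ^ 2 ≤ ‖(t : ℂ) ^ 2 + z ^ 2‖ + R ^ 2 := by
    have h := norm_sub_le ((t : ℂ) ^ 2 + z ^ 2) (z ^ 2)
    rw [add_sub_cancel_right, norm_pow, norm_pow, Complex.norm_real, Real.norm_eq_abs, sq_abs] at h
    have : ‖z‖ ^ 2 ≤ R ^ 2 := pow_le_pow_left₀ (norm_nonneg _) hR 2
    linarith
  have h2 : 1 + R ^ 2 ≤ (1 + R ^ 2) / r ^ 2 * ‖(t : ℂ) ^ 2 + z ^ 2‖ := by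
    rw [div_mul_eq_mul_div, le_div_iff₀ hr2]
    exact mul_le_mul_of_nonneg_left h0 (by positivity)
  rw [norm_inv, ← div_eq_mul_inv, le_div_iff₀ (by positivity), inv_mul_le_iff₀ hpos]
  linarith

theorem continuous_inv_sq_add_sq {z : ℂ} (hz : 0 < z.re) :
    Continuous fun t : ℝ => ((t : ℂ) ^ 2 + z ^ 2)⁻¹ :=
  Continuous.inv₀ (by fun_prop) (ofReal_sq_add_sq_ne_zero hz)

/-- A bound for `∏ 1 / (t² + xᵢ²)`, uniform in `x`. -/
theorem norm_prod_inv_sq_add_sq_le {n : ℕ} {x : Fin (n + 1) → ℂ} {r R : ℝ} (hr : 0 < r)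
    (hx : ∀ i, r ≤ (x i).re) (hR : ∀ i, ‖x i‖ ≤ R) (t : ℝ) :
    ‖∏ i, ((t : ℂ) ^ 2 + x i ^ 2)⁻¹‖ ≤ ((1 + R ^ 2) / r ^ 2 + 1) ^ (n + 1) * (1 + t ^ 2)⁻¹ := by
  have hC : 0 ≤ (1 + R ^ 2) / r ^ 2 + 1 := by positivity
  have ht : (1 + t ^ 2)⁻¹ ≤ 1 := inv_le_one_of_one_le₀ (by nlinarith [sq_nonneg t])
  rw [norm_prod]
  calc ∏ i, ‖((t : ℂ) ^ 2 + x i ^ 2)⁻¹‖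
      ≤ ∏ _i : Fin (n + 1), ((1 + R ^ 2) / r ^ 2 + 1) * (1 + t ^ 2)⁻¹ :=
        Finset.prod_le_prod (fun _ _ => norm_nonneg _)
          fun i _ => norm_inv_sq_add_sq_le hr (hx i) (hR i) t
    _ = ((1 + R ^ 2) / r ^ 2 + 1) ^ (n + 1) * ((1 + t ^ 2)⁻¹) ^ (n + 1) := by
        rw [Finset.prod_const, Finset.card_univ, Fintype.card_fin, mul_pow]
    _ ≤ _ := by
        refine mul_le_mul_of_nonneg_left ?_ (by positivity)
        exact pow_le_of_le_one (by positivity) ht (by omega)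

open MeasureTheory in
theorem integrable_prod_inv_sq_add_sq {n : ℕ} {x : Fin (n + 1) → ℂ} (hx : ∀ i, 0 < (x i).re) :
    Integrable fun t : ℝ => ∏ i, ((t : ℂ) ^ 2 + x i ^ 2)⁻¹ := by
  obtain ⟨i₀, -, hi₀⟩ := Finset.exists_min_image Finset.univ (fun i => (x i).re)
    ⟨0, Finset.mem_univ _⟩
  refine (integrable_inv_one_add_sq.const_mul
    (((1 + (∑ i, ‖x i‖) ^ 2) / (x i₀).re ^ 2 + 1) ^ (n + 1))).mono' ?_ ?_
  · exact (continuous_finsetProd _ fun i _ => continuous_inv_sq_add_sq (hx i)).aestronglyMeasurable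
  · exact Filter.Eventually.of_forall <| norm_prod_inv_sq_add_sq_le (hx i₀)
      (fun i => hi₀ i (Finset.mem_univ i))
      fun i => Finset.single_le_sum (f := fun i => ‖x i‖) (fun _ _ => norm_nonneg _)
        (Finset.mem_univ i)

open MeasureTheory in
theorem integrable_inv_sq_add_sq {z : ℂ} (hz : 0 < z.re) :
    Integrable fun t : ℝ => ((t : ℂ) ^ 2 + z ^ 2)⁻¹ := by
  simpa using integrable_prod_inv_sq_add_sq (n := 0) (x := fun _ => z) fun _ => hz

/-! ### The integral with a single factor. -/

open MeasureTheory Filter Topology in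
theorem integral_Ioi_inv_sq_add_sq {z : ℂ} (hz : 0 < z.re) :
    ∫ t in Set.Ioi (0 : ℝ), ((t : ℂ) ^ 2 + z ^ 2)⁻¹ = Real.pi / 2 * z⁻¹ := by
  have hz0 : z ≠ 0 := fun h => by simp [h] at hz
  -- A logarithmic antiderivative suits complex `z`: the arguments have imaginary parts `∓Re z ≠ 0`,
  -- so they avoid the branch cut.
  set f : ℝ → ℂ := fun t =>
    (Complex.log (t - Complex.I * z) - Complex.log (t + Complex.I * z)) / (2 * Complex.I * z)
    with hf
  have hm : ∀ t : ℝ, (t : ℂ) - Complex.I * z ∈ Complex.slitPlane := fun t =>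
    Or.inr (by simp [hz.ne'])
  have hp : ∀ t : ℝ, (t : ℂ) + Complex.I * z ∈ Complex.slitPlane := fun t =>
    Or.inr (by simp [hz.ne'])
  have hderiv : ∀ t ∈ Set.Ici (0 : ℝ), HasDerivAt f (((t : ℂ) ^ 2 + z ^ 2)⁻¹) t := by
    intro t _
    have hid : HasDerivAt (fun s : ℝ => (s : ℂ)) 1 t := Complex.ofRealCLM.hasDerivAt
    have h1 := (hid.sub_const (Complex.I * z)).clog_real (hm t)
    have h2 := (hid.add_const (Complex.I * z)).clog_real (hp t)
    refine ((h1.sub h2).div_const (2 * Complex.I * z)).congr_deriv ?_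
    have hm0 := Complex.slitPlane_ne_zero (hm t)
    have hp0 := Complex.slitPlane_ne_zero (hp t)
    have hfac : (t : ℂ) ^ 2 + z ^ 2 = (t - Complex.I * z) * (t + Complex.I * z) := by
      linear_combination z ^ 2 * Complex.I_sq
    rw [hfac]
    field_simp
    ring
  have hlim : Tendsto f atTop (𝓝 0) := by
    -- For `t > 0` the common `log t` cancels from the difference.
    have hg : Tendsto (fun t : ℝ => (Complex.log (1 - Complex.I * z * (t⁻¹ : ℝ)) -
        Complex.log (1 + Complex.I * z * (t⁻¹ : ℝ))) / (2 * Complex.I * z)) atTop (𝓝 0) := by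
      have hinv : Tendsto (fun t : ℝ => ((t⁻¹ : ℝ) : ℂ)) atTop (𝓝 0) := by
        simpa only [Complex.ofReal_zero, Function.comp_def] using
          (Complex.continuous_ofReal.tendsto 0).comp tendsto_inv_atTop_zero
      have h1 : Tendsto (fun t : ℝ => 1 - Complex.I * z * (t⁻¹ : ℝ)) atTop (𝓝 1) := by
        simpa using (hinv.const_mul (Complex.I * z)).const_sub 1
      have h2 : Tendsto (fun t : ℝ => 1 + Complex.I * z * (t⁻¹ : ℝ)) atTop (𝓝 1) := by
        simpa using (hinv.const_mul (Complex.I * z)).const_add 1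
      have h := ((h1.clog Complex.one_mem_slitPlane).sub
        (h2.clog Complex.one_mem_slitPlane)).div_const (2 * Complex.I * z)
      simpa using h
    refine hg.congr' ?_
    filter_upwards [eventually_gt_atTop 0] with t ht
    have htc : (t : ℂ) ≠ 0 := by exact_mod_cast ht.ne'
    have e1 : (t : ℂ) - Complex.I * z = t * (1 - Complex.I * z * (t⁻¹ : ℝ)) := by
      push_cast; field_simp
    have e2 : (t : ℂ) + Complex.I * z = t * (1 + Complex.I * z * (t⁻¹ : ℝ)) := by
      push_cast; field_simp
    have n1 := Complex.slitPlane_ne_zero (hm t)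
    have n2 := Complex.slitPlane_ne_zero (hp t)
    rw [e1] at n1
    rw [e2] at n2
    simp only [hf]
    rw [e1, e2, Complex.log_ofReal_mul ht (right_ne_zero_of_mul n1),
      Complex.log_ofReal_mul ht (right_ne_zero_of_mul n2)]
    ring
  have hf0 : f 0 = -(Real.pi / 2 * z⁻¹) := by
    have harg := Complex.abs_arg_lt_pi_div_two_iff.2 (Or.inl hz)
    rw [abs_lt] at harg
    -- As `|arg z| < π/2`, multiplying by `±i` keeps the argument in the principal range.
    have e1 : Complex.log (Complex.I * z) = Complex.log Complex.I + Complex.log z := by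
      refine Complex.log_mul Complex.I_ne_zero hz0 ?_
      rw [Complex.arg_I]
      constructor <;> linarith [Real.pi_pos]
    have e2 : Complex.log (-Complex.I * z) = Complex.log (-Complex.I) + Complex.log z := by
      refine Complex.log_mul (neg_ne_zero.2 Complex.I_ne_zero) hz0 ?_
      rw [Complex.arg_neg_I]
      constructor <;> linarith [Real.pi_pos]
    simp only [hf, Complex.ofReal_zero, zero_sub, zero_add]
    rw [← neg_mul, e1, e2, Complex.log_I, Complex.log_neg_I]
    field_simp
    ring
  rw [integral_Ioi_of_hasDerivAt_of_tendsto' hderiv (integrable_inv_sq_add_sq hz).integrableOn hlim,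
    hf0]
  ring

/-! ### Distinct nodes. -/

/-- Partial fractions, read off from the barycentric form of the constant `1` interpolated at the
nodes `-yᵢ`. -/
theorem prod_inv_add_eq_sum {n : ℕ} {y : Fin (n + 1) → ℂ} (hy : Function.Injective y) {T : ℂ}
    (hT : ∀ i, T + y i ≠ 0) :
    ∏ i, (T + y i)⁻¹ =
      (-1) ^ n * ∑ i, (∏ j ∈ Finset.univ.erase i, (y i - y j))⁻¹ * (T + y i)⁻¹ := by
  have hinj : Set.InjOn (fun i => -y i) (Finset.univ : Finset (Fin (n + 1))) :=
    (neg_injective.comp hy).injOn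
  have h := Lagrange.eval_interpolate_not_at_node (s := Finset.univ) (v := fun i => -y i) (x := T)
    1 (fun i _ h => hT i (by rw [h]; ring))
  rw [Lagrange.interpolate_one hinj Finset.univ_nonempty, Polynomial.eval_one,
    Lagrange.eval_nodal] at h
  have hw : ∀ i, Lagrange.nodalWeight Finset.univ (fun i => -y i) i =
      (-1) ^ n * (∏ j ∈ Finset.univ.erase i, (y i - y j))⁻¹ := by
    intro i
    have e : ∀ j, (-y i - -y j)⁻¹ = (-1) * (y i - y j)⁻¹ := fun j => by
      rw [neg_one_mul, ← inv_neg]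
      congr 1
      ring
    simp [Lagrange.nodalWeight, e, Finset.prod_mul_distrib, Finset.prod_const,
      -neg_mul, -sub_neg_eq_add, -one_mul]
  simp only [sub_neg_eq_add, Pi.one_apply, mul_one, hw, mul_assoc, ← Finset.mul_sum] at h
  rw [Finset.prod_inv_distrib]
  exact inv_eq_of_mul_eq_one_right h.symm

open MeasureTheory in
theorem integral_prod_inv_sq_add_sq_of_injective {n : ℕ} {x : Fin (n + 1) → ℂ}
    (hx : ∀ i, 0 < (x i).re) (hinj : Function.Injective x) :
    (∏ i, x i) * schur (staircase (n + 1) (n + 1)) x *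
        ∫ t in Set.Ioi (0 : ℝ), ∏ i, ((t : ℂ) ^ 2 + x i ^ 2)⁻¹ =
      Real.pi / 2 * schur (staircase (n + 1) n) x := by
  have hy : Function.Injective fun i => x i ^ 2 := by
    intro i j hij
    have h : (x i - x j) * (x i + x j) = 0 := by
      have : x i ^ 2 = x j ^ 2 := hij
      linear_combination this
    rcases mul_eq_zero.1 h with h | h
    · exact hinj (sub_eq_zero.1 h)
    · have := congrArg Complex.re h
      simp only [Complex.add_re, Complex.zero_re] at this
      linarith [hx i, hx j]
  have hx0 : ∀ i, x i ≠ 0 := fun i h => by simpa [h] using hx i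
  rw [schur_staircase_eq hx0 hy]
  simp_rw [fun t : ℝ => prod_inv_add_eq_sum hy fun i => ofReal_sq_add_sq_ne_zero (hx i) t]
  rw [integral_const_mul, integral_finsetSum _
    fun i _ => ((integrable_inv_sq_add_sq (hx i)).const_mul _).integrableOn]
  simp_rw [integral_const_mul, fun i => integral_Ioi_inv_sq_add_sq (hx i)]
  have : ∀ i, (∏ j ∈ Finset.univ.erase i, (x i ^ 2 - x j ^ 2))⁻¹ * (Real.pi / 2 * (x i)⁻¹) =
      Real.pi / 2 * ((x i)⁻¹ / ∏ j ∈ Finset.univ.erase i, (x i ^ 2 - x j ^ 2)) := fun i => by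
    ring
  simp_rw [this, ← Finset.mul_sum]
  ring

/-! ### Repeated nodes, by perturbation and continuity. -/

open Filter Topology in
theorem eventually_injective_add_mul {n : ℕ} (q : Fin n → ℂ) :
    ∀ᶠ ε : ℝ in 𝓝[≠] 0, Function.Injective fun i : Fin n => q i + ε * (i : ℕ) := by
  have h : ∀ i j : Fin n, ∀ᶠ ε : ℝ in 𝓝[≠] 0,
      q i + ε * (i : ℕ) = q j + ε * (j : ℕ) → i = j := by
    intro i j
    by_cases hq : q i = q j
    · filter_upwards [self_mem_nhdsWithin] with ε hε h
      rw [hq, add_right_inj] at h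
      exact Fin.ext (by exact_mod_cast mul_left_cancel₀ (Complex.ofReal_ne_zero.2 hε) h)
    · have hc : ∀ k : Fin n, Tendsto (fun ε : ℝ => q k + ε * (k : ℕ)) (𝓝[≠] 0) (𝓝 (q k)) := by
        intro k
        have : Continuous fun ε : ℝ => q k + ε * ((k : ℕ) : ℂ) := by fun_prop
        simpa using (this.tendsto 0).mono_left nhdsWithin_le_nhds
      filter_upwards [((hc i).sub (hc j)).eventually_ne (sub_ne_zero.2 hq)] with ε hε h
      exact absurd (sub_eq_zero.2 h) hε
  simpa only [Function.Injective, eventually_all] using h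

theorem continuous_schur {n : ℕ} (μ : Fin n → ℕ) : Continuous (schur μ) := by
  unfold schur
  simp only [MvPolynomial.aeval_eq_eval₂Hom, MvPolynomial.coe_eval₂Hom, MvPolynomial.eval₂_eq]
  fun_prop

open MeasureTheory Filter Topology in
/-- The integral of `∏ 1 / (t² + xᵢ²)` over the half-line as a quotient of Schur polynomials. -/
theorem integral_prod_inv_sq_add_sq {n : ℕ} {x : Fin (n + 1) → ℂ} (hx : ∀ i, 0 < (x i).re) :
    (∏ i, x i) * schur (staircase (n + 1) (n + 1)) x *
        ∫ t in Set.Ioi (0 : ℝ), ∏ i, ((t : ℂ) ^ 2 + x i ^ 2)⁻¹ =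
      Real.pi / 2 * schur (staircase (n + 1) n) x := by
  obtain ⟨r, hr, hrx⟩ : ∃ r > 0, ∀ i, r < (x i).re := by
    obtain ⟨i₀, -, hi₀⟩ := Finset.exists_min_image Finset.univ (fun i => (x i).re)
      ⟨0, Finset.mem_univ _⟩
    exact ⟨(x i₀).re / 2, half_pos (hx i₀), fun i =>
      (half_lt_self (hx i₀)).trans_le (hi₀ i (Finset.mem_univ i))⟩
  obtain ⟨R, hR⟩ : ∃ R, ∀ i, ‖x i‖ < R :=
    ⟨∑ i, ‖x i‖ + 1, fun i => (Finset.single_le_sum (f := fun i => ‖x i‖)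
      (fun _ _ => norm_nonneg _) (Finset.mem_univ i)).trans_lt (lt_add_one _)⟩
  set p : ℝ → Fin (n + 1) → ℂ := fun ε i => x i + ε * (i : ℕ) with hp
  have hpx : Tendsto p (𝓝[≠] 0) (𝓝 x) := by
    have : Continuous p := by fun_prop
    simpa [hp] using (this.tendsto 0).mono_left nhdsWithin_le_nhds
  have hre : ∀ᶠ ε in 𝓝[≠] 0, ∀ i, r < (p ε i).re := eventually_all.2 fun i =>
    ((Complex.continuous_re.tendsto _).comp (tendsto_pi_nhds.1 hpx i)).eventually_const_lt (hrx i)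
  have hnorm : ∀ᶠ ε in 𝓝[≠] 0, ∀ i, ‖p ε i‖ < R := eventually_all.2 fun i =>
    (tendsto_pi_nhds.1 hpx i).norm.eventually_lt_const (hR i)
  have hI : Tendsto (fun ε => ∫ t in Set.Ioi (0 : ℝ), ∏ i, ((t : ℂ) ^ 2 + p ε i ^ 2)⁻¹) (𝓝[≠] 0)
      (𝓝 (∫ t in Set.Ioi (0 : ℝ), ∏ i, ((t : ℂ) ^ 2 + x i ^ 2)⁻¹)) := by
    -- The bounds `r` and `R` hold for all nearby nodes, so one majorant serves every small `ε`.
    refine tendsto_integral_filter_of_dominated_convergence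
      (fun t => ((1 + R ^ 2) / r ^ 2 + 1) ^ (n + 1) * (1 + t ^ 2)⁻¹) ?_ ?_
      (integrable_inv_one_add_sq.const_mul _).integrableOn ?_
    · filter_upwards [hre] with ε h1
      exact (integrable_prod_inv_sq_add_sq fun i => hr.trans (h1 i)).aestronglyMeasurable.restrict
    · filter_upwards [hre, hnorm] with ε h1 h2
      exact Eventually.of_forall
        (norm_prod_inv_sq_add_sq_le hr (fun i => (h1 i).le) fun i => (h2 i).le)
    · refine Eventually.of_forall fun t => tendsto_finsetProd _ fun i _ => ?_
      exact (((tendsto_pi_nhds.1 hpx i).pow 2).const_add _).inv₀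
        (ofReal_sq_add_sq_ne_zero (hx i) t)
  have hP : Tendsto (fun ε => ∏ i, p ε i) (𝓝[≠] 0) (𝓝 (∏ i, x i)) :=
    tendsto_finsetProd _ fun i _ => tendsto_pi_nhds.1 hpx i
  refine tendsto_nhds_unique_of_eventuallyEq
    ((hP.mul (((continuous_schur _).tendsto _).comp hpx)).mul hI)
    ((((continuous_schur _).tendsto _).comp hpx).const_mul _) ?_
  filter_upwards [hre, eventually_injective_add_mul x] with ε h1 h2
  exact integral_prod_inv_sq_add_sq_of_injective (fun i => hr.trans (h1 i)) h2

/-! ### Specialization to the quartic. -/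

theorem prod_quarticTuple {M : Type*} [CommMonoid M] (f : ℂ → M) (w : ℂ) (m : ℕ) :
    ∏ i, f (quarticTuple w m i) = (f w * f w⁻¹) ^ (m + 1) := by
  have h : ∏ i : Fin (2 * m + 2), f (quarticTuple w m i) =
      ∏ i ∈ Finset.range ((m + 1) + (m + 1)), f (if i < m + 1 then w else w⁻¹) := by
    rw [show (m + 1) + (m + 1) = 2 * m + 2 by ring, Finset.prod_range]
    rfl
  rw [h, Finset.prod_range_add, mul_pow]
  congr 1
  · rw [Finset.prod_congr rfl fun i hi => by rw [if_pos (Finset.mem_range.1 hi)]]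
    simp
  · simp [show ∀ k, ¬m + 1 + k ≤ m by omega]

theorem mainTheorem3 (a : ℝ) (ha : -1 < a) (m : ℕ) (w : ℂ) (hw : 0 < w.re)
    (haw : (a : ℂ) = (w ^ 2 + (w⁻¹) ^ 2) / 2) :
    MeasureTheory.IntegrableOn
        (fun x : ℝ => 1 / (x ^ 4 + 2 * a * x ^ 2 + 1) ^ (m + 1)) (Set.Ioi 0) ∧
      schur (staircase (2 * m + 2) (2 * m + 2)) (quarticTuple w m) ≠ 0 ∧
      (quarticIntegral a m : ℂ) =
        (Real.pi / 2 : ℂ) *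
          (schur (staircase (2 * m + 2) (2 * m + 1)) (quarticTuple w m) /
            schur (staircase (2 * m + 2) (2 * m + 2)) (quarticTuple w m)) := by
  have hw0 : w ≠ 0 := fun h => by simp [h] at hw
  have hq : ∀ i, 0 < (quarticTuple w m i).re := by
    intro i
    unfold quarticTuple
    split_ifs
    · exact hw
    · rw [Complex.inv_re]
      exact div_pos hw (Complex.normSq_pos.2 hw0)
  have hprod : ∀ t : ℝ, ∏ i, ((t : ℂ) ^ 2 + quarticTuple w m i ^ 2)⁻¹ =
      ((1 / (t ^ 4 + 2 * a * t ^ 2 + 1) ^ (m + 1) : ℝ) : ℂ) := by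
    intro t
    rw [prod_quarticTuple fun z => ((t : ℂ) ^ 2 + z ^ 2)⁻¹, ← mul_inv, inv_pow, one_div]
    push_cast
    rw [haw]
    congr 2
    linear_combination (w * w⁻¹ + 1) * mul_inv_cancel₀ hw0
  have hint := integrable_prod_inv_sq_add_sq (n := 2 * m + 1) hq
  have hS := schur_staircase_ne_zero hq
  have hI := integral_prod_inv_sq_add_sq (n := 2 * m + 1) hq
  -- The entries of the tuple multiply to `1`, which removes the prefactor `∏ xᵢ`.
  rw [prod_quarticTuple fun z => z, mul_inv_cancel₀ hw0, one_pow, one_mul] at hI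
  simp_rw [hprod] at hint hI
  rw [integral_complex_ofReal] at hI
  refine ⟨?_, hS, ?_⟩
  · simpa only [RCLike.re_eq_complex_re, Complex.ofReal_re] using hint.re.integrableOn
  · rw [mul_div_assoc', eq_div_iff hS, ← hI, mul_comm]
    rfl
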